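/- Let $X\in\mathbb{R}^{n\times p}$ be a fixed design, $Y=(Y_1,\dots,Y_n)^T$ a random response and $\bar\beta\in\mathbb{R}^p$ with support $\bar F=\{j:\bar\beta_j\ne 0\}$. Divide the $n$ observations into $K$ folds of equal size and let $(Y^k,X^k)$ be the subsample obtained by removing the $k$-th fold; it has $n_k=n(K-1)/K$ observations. Put $\widetilde p=\min\{n_k,p\}$, and let $\mathbf{x}_1,\dots,\mathbf{x}_p$ denote the columns of $X^k$. For $F\subseteq\{1,\dots,p\}$ let $X^k_F$ be the matrix of the columns with index in $F$, and $$\mu(F)=\max_{j\notin F}\big\|\big((X^k_F)^TX^k_F\big)^{-1}(X^k_F)^T\mathbf{x}_j\big\|_1,\qquad \rho(F)=\inf\Big\{\tfrac{1}{n_k}\|X^k\beta\|_2^2/\|\beta\|_2^2:\ \beta\neq0,\ \mathrm{supp}(\beta)\subseteq F\Big\}$$ (with $\max\emptyset=0$ and $\inf\emptyset=+\infty$). Assume on the subsample: $\|\mathbf{x}_j\|_2^2/n_k=1$ for every $j$; $\mathbb{E}(Y^k)=X^k\bar\beta$; $\mu(\bar F)<1$ and $\rho(\bar F)>0$; and for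 some $\sigma>0$ the entries of $Y^k$ are independent with $\mathbb{E}\,e^{t(Y^k_i-\mathbb{E}Y^k_i)}\le e^{\sigma^2t^2/2}$ for all $t\in\mathbb{R}$ and all $i$. Run forward selection on $(Y^k,X^k)$ for $\widetilde p$ stages: at stage $s$ include a not yet included variable $\mathbf{x}^{(s)}$ that maximizes $|\widetilde{\mathbf{x}}_j^Tu^{(s-1)}|$, where $\widetilde{\mathbf{x}}_j=\mathbf{x}_j/\|\mathbf{x}_j\|_2$ and $u^{(s-1)}$ is the least squares residual of $Y^k$ on the variables included at stages $1,\dots,s-1$. Put $\omega^{(s)}=|(\widetilde{\mathbf{x}}^{(s)})^Tu^{(s-1)}|$, and $\widehat q^{\,k}_j=(\widetilde p+1-s)/\widetilde p$ if $\mathbf{x}_j$ is included at stage $s$, $\widehat q^{\,k}_j=0$ if it is never included. For $\varepsilon\in\mathbb{R}$, the procedure is said to stop at stage $l$ (under the $\varepsilon$ stopping rule) if $\omega^{(s)}>\varepsilon$ for all $s<l$ while $|\widetilde{\mathbf{x}}_j^Tu^{(l-1)}|\le\varepsilon$ for every variable not included before stage $l$. Then for every $\eta\in(0,1)$, with probability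 larger than $1-\eta$ the following holds, for all ways of breaking ties, all $\varepsilon\in\mathbb{R}$ and all $l$ with $2\le l\le\widetilde p+1$ simultaneously. If the procedure stops at stage $l$ and the $\omega$ stopping condition $$\omega^{(s)}>\frac{1}{1-\mu(\bar F)}\,\sigma\sqrt{2\ln(4p/\eta)}$$ is satisfied at every stage $s=1,\dots,l-1$, then, with $c^k=(\widetilde p+1-l)/\widetilde p$ and $\omega=\omega^{(l-1)}$ (the value at the last variable selected before stopping), $$\{j:\widehat q^{\,k}_j>c^k\}\subseteq\bar F$$ and $$\big|\bar F\setminus\{j:\widehat q^{\,k}_j>c^k\}\big|\le 2\,\Big|\Big\{j\in\bar F:\ |\bar\beta_j|<\frac{3\omega}{\rho(\bar F)\sqrt{n(K-1)/K}}\Big\}\Big|.$$ -/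

import Mathlib

open MeasureTheory ProbabilityTheory
open scoped Matrix

/-- Observations kept in the `k`-th subsample: all those outside the `k`-th fold. -/
abbrev SubIdx {n K : ℕ} (fold : Fin n → Fin K) (k : Fin K) : Type :=
  {i : Fin n // fold i ≠ k}

/-- Design matrix of the `k`-th subsample. -/
def subDesign {n p K : ℕ} (X : Matrix (Fin n) (Fin p) ℝ) (fold : Fin n → Fin K) (k : Fin K) :
    Matrix (SubIdx fold k) (Fin p) ℝ :=
  fun i j => X i.1 j

/-- Response of the `k`-th subsample. -/
def subResponse {Ω : Type*} {n K : ℕ} (Y : Fin n → Ω → ℝ) (fold : Fin n → Fin K) (k : Fin K) :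
    SubIdx fold k → Ω → ℝ :=
  fun i => Y i.1

/-- `p̃ = min {n (K - 1) / K, p}` (the division is exact when the folds have equal sizes). -/
def pTilde (n K p : ℕ) : ℕ := min (n * (K - 1) / K) p

noncomputable section

/-- Support of a coefficient vector. -/
def coefSupp {p : ℕ} (β : Fin p → ℝ) : Finset (Fin p) :=
  Finset.univ.filter (fun j => β j ≠ 0)

/-- The columns of `X` with index in `F`. -/
def colsOf {ι : Type*} {p : ℕ} (X : Matrix ι (Fin p) ℝ) (F : Finset (Fin p)) :
    Matrix ι {j // j ∈ F} ℝ :=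
  fun i j => X i j.1

/-- `μ_X(F) = max_{j ∉ F} ‖(X_Fᵀ X_F)⁻¹ X_Fᵀ x_j‖₁` (equal to `0` if there is no `j ∉ F`). -/
def muX {ι : Type*} [Fintype ι] {p : ℕ} (X : Matrix ι (Fin p) ℝ) (F : Finset (Fin p)) : ℝ :=
  ⨆ j : {j : Fin p // j ∉ F},
    ∑ i, |(((colsOf X F)ᵀ * colsOf X F)⁻¹ *ᵥ ((colsOf X F)ᵀ *ᵥ fun i' => X i' j.1)) i|

/-- `ρ_X(F) = inf {(‖Xβ‖₂² / n) / ‖β‖₂² : β ≠ 0, supp β ⊆ F}`, where `n` is the number of rows.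
Only used for nonempty `F`, for which the set is nonempty. -/
def rhoX {ι : Type*} [Fintype ι] {p : ℕ} (X : Matrix ι (Fin p) ℝ) (F : Finset (Fin p)) : ℝ :=
  sInf {r : ℝ | ∃ β : Fin p → ℝ, β ≠ 0 ∧ coefSupp β ⊆ F ∧
    r = ((∑ i, (X *ᵥ β) i ^ 2) / (Fintype.card ι : ℝ)) / ∑ j, β j ^ 2}

/-- The standing assumptions on a data set with fixed design `X`, random response `Y`,
true coefficients `β` and noise level `σ`. -/
structure DataAssumptions {Ω : Type*} [MeasurableSpace Ω] (P : Measure Ω)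
    {ι : Type*} [Fintype ι] {p : ℕ} (X : Matrix ι (Fin p) ℝ) (Y : ι → Ω → ℝ)
    (β : Fin p → ℝ) (σ : ℝ) : Prop where
  /-- every column satisfies `‖x_j‖₂² / n = 1` -/
  normalized : ∀ j, (∑ i, X i j ^ 2) / (Fintype.card ι : ℝ) = 1
  /-- `E Y = X β` -/
  mean_eq : ∀ i, ∫ w, Y i w ∂P = (X *ᵥ β) i
  /-- irrepresentable condition -/
  irrepresentable : muX X (coefSupp β) < 1
  /-- sparse eigenvalue condition (for an empty support the infimum is `+∞`) -/
  sparse_eigenvalue : (coefSupp β).Nonempty → 0 < rhoX X (coefSupp β)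
  measurable : ∀ i, Measurable (Y i)
  indep : iIndepFun Y P
  sigma_pos : 0 < σ
  /-- `E exp (t (Y_i - E Y_i)) ≤ exp (σ² t² / 2)` for all real `t` -/
  subgaussian : ∀ i,
    HasSubgaussianMGF (fun w => Y i w - ∫ w', Y i w' ∂P) ⟨σ ^ 2, sq_nonneg σ⟩ P

/-- `b` is a least squares solution with coefficients restricted to `F`. -/
def IsLeastSquares {ι : Type*} [Fintype ι] {p : ℕ} (X : Matrix ι (Fin p) ℝ) (y : ι → ℝ)
    (F : Finset (Fin p)) (b : Fin p → ℝ) : Prop :=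
  coefSupp b ⊆ F ∧ ∀ b' : Fin p → ℝ, coefSupp b' ⊆ F →
    ∑ i, ((X *ᵥ b) i - y i) ^ 2 ≤ ∑ i, ((X *ᵥ b') i - y i) ^ 2

/-- Regression residual `u = y - X b`. -/
def resid {ι : Type*} [Fintype ι] {p : ℕ} (X : Matrix ι (Fin p) ℝ) (y : ι → ℝ)
    (b : Fin p → ℝ) : ι → ℝ :=
  fun i => y i - (X *ᵥ b) i

/-- `|x̃_jᵀ u|`, where `x̃_j = x_j / ‖x_j‖₂` is the `j`-th column scaled to unit length. -/
def absCorr {ι : Type*} [Fintype ι] {p : ℕ} (X : Matrix ι (Fin p) ℝ) (u : ι → ℝ)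
    (j : Fin p) : ℝ :=
  |∑ i, X i j * u i| / √(∑ i, X i j ^ 2)

/-- The variables included in the first `m` stages of a path; the variable included at
stage `s + 1` is `path s`. -/
def firstVars {p N : ℕ} (path : Fin N → Fin p) (m : ℕ) : Finset (Fin p) :=
  (Finset.univ.filter (fun s : Fin N => (s : ℕ) < m)).image path

/-- An unrestricted run of forward selection with `N` stages on the data `(y, X)`: `path s` is the
variable included at stage `s + 1`, and `b m` are the regression coefficients after `m` stages.
At each stage, a not yet included variable with maximal `|x̃_jᵀ u|` is included, where `u` is the
residual of the previous stage. -/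
structure IsForwardSelection {ι : Type*} [Fintype ι] {p N : ℕ} (X : Matrix ι (Fin p) ℝ)
    (y : ι → ℝ) (path : Fin N → Fin p) (b : ℕ → Fin p → ℝ) : Prop where
  injective : Function.Injective path
  leastSquares : ∀ m, m ≤ N → IsLeastSquares X y (firstVars path m) (b m)
  greedy : ∀ s : Fin N, ∀ j, j ∉ firstVars path s →
    absCorr X (resid X y (b s)) j ≤ absCorr X (resid X y (b s)) (path s)

/-- `ω` of the variable included at stage `s + 1`: its `|x̃ᵀ u|`, with `u` the residual of the
previous stage. -/
def stageOmega {ι : Type*} [Fintype ι] {p N : ℕ} (X : Matrix ι (Fin p) ℝ)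
    (y : ι → ℝ) (path : Fin N → Fin p) (b : ℕ → Fin p → ℝ) (s : Fin N) : ℝ :=
  absCorr X (resid X y (b s)) (path s)

/-- The `ε` stopping rule stops forward selection at stage `l`: every variable included before
stage `l` had `|x̃ᵀ u| > ε`, and prior to stage `l` no variable still unselected has
`|x̃_jᵀ u| > ε`. -/
def StopsAt {ι : Type*} [Fintype ι] {p N : ℕ} (X : Matrix ι (Fin p) ℝ)
    (y : ι → ℝ) (path : Fin N → Fin p) (b : ℕ → Fin p → ℝ) (ε : ℝ) (l : ℕ) : Prop :=
  (∀ s : Fin N, (s : ℕ) + 1 < l → ε < stageOmega X y path b s) ∧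
    ∀ j, j ∉ firstVars path (l - 1) → absCorr X (resid X y (b (l - 1))) j ≤ ε

/-- `q̂_j = (N + 1 - l) / N` if the `j`-th variable is included at stage `l`, and `0` if it is
never included (for an injective path the sum has at most one nonzero term). -/
def qHat {p N : ℕ} (path : Fin N → Fin p) (j : Fin p) : ℝ :=
  ∑ s : Fin N, if path s = j then ((N : ℝ) + 1 - ((s : ℝ) + 1)) / (N : ℝ) else 0

/-- The threshold `c = (N + 1 - l) / N`. -/
def cThreshold (N l : ℕ) : ℝ := ((N : ℝ) + 1 - (l : ℝ)) / (N : ℝ)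

/-- `{x_j : q̂_j > c}`. -/
def qSelected {p N : ℕ} (path : Fin N → Fin p) (c : ℝ) : Finset (Fin p) :=
  Finset.univ.filter (fun j => c < qHat path j)

end

/-! ### Subgaussian concentration of finitely many linear forms -/

/-! All randomness is confined to p linear forms of the noise whose coefficient vectors, `dualCol`,
depend only on the design and on F = supp β̄. One union bound therefore controls them once and for
all, and the rest is deterministic, uniformly in ties, ε and l. Write N for the number of rows, t =
σ√(2 ln(4p/η)), and u for the current residual.

No false inclusion (`path_mem_coefSupp`): suppose only variables of F were included so far and the
next one, x_j, lies outside F. Split x_j into its projection on the span of F and the remainder. The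
projection contributes at most μ√N ω to the correlation with u, by the greedy choice; the remainder
is orthogonal to all signal and fit, so it sees only noise, at most √N t. Hence ω ≤ μω + t, against
the `ω` condition.

Few misses (`card_sdiff_le_of_absCorr_le`): let d be the coefficients of u regressed on F, S the
included set, and τ = ω/(ρ√N). Since u is orthogonal to the columns of S and has small correlation
with the others, the eigenvalue bound gives Σ_{F∖S} (d_j² − τ|d_j|) ≤ 0. On F∖S, d_j is β̄_j plus
noise of size at most τ, so each missed j with |β̄_j| ≥ 3τ adds at least 2τ², while any other term
is at least −τ²/4. Missed large coefficients are thus no more numerous than missed small ones,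
whence the factor 2. -/

theorem HasSubgaussianMGF.mono_proxy {Ω : Type*} [MeasurableSpace Ω] {P : Measure Ω} {Z : Ω → ℝ}
    {c c' : NNReal} (h : HasSubgaussianMGF Z c P) (hc : c ≤ c') : HasSubgaussianMGF Z c' P where
  integrable_exp_mul := h.integrable_exp_mul
  mgf_le t := (h.mgf_le t).trans <| Real.exp_le_exp.2 <| by
    have : (c : ℝ) ≤ c' := hc
    gcongr

/-- Independence makes the form subgaussian with proxy ‖a‖²σ² ≤ Vσ², and the Chernoff bound is
applied to both tails. A separate V keeps the proxy positive even when a = 0. -/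
theorem measure_abs_linear_gt_le {Ω : Type*} [MeasurableSpace Ω] {P : Measure Ω}
    [IsProbabilityMeasure P] {ι : Type*} [Fintype ι] {ξ : ι → Ω → ℝ} (hind : iIndepFun ξ P)
    {σ : ℝ} (hsub : ∀ i, HasSubgaussianMGF (ξ i) ⟨σ ^ 2, sq_nonneg σ⟩ P) (hσ : 0 < σ)
    (a : ι → ℝ) {V : ℝ} (hV : 0 < V) (ha : a ⬝ᵥ a ≤ V) {L : ℝ} (hL : 0 ≤ L) :
    P.real {w | √V * (σ * √(2 * L)) < |a ⬝ᵥ fun i => ξ i w|} ≤ 2 * Real.exp (-L) := by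
  have hs : HasSubgaussianMGF (fun w => a ⬝ᵥ fun i => ξ i w)
      ⟨V * σ ^ 2, by positivity⟩ P := by
    have h1 : iIndepFun (fun i w => a i * ξ i w) P :=
      hind.comp (fun i x => a i * x) (fun i => measurable_const_mul (a i))
    have h2 := HasSubgaussianMGF.sum_of_iIndepFun h1 (s := Finset.univ)
      (fun i _ => (hsub i).const_mul (a i))
    suffices hle : ∑ i, NNReal.mk (a i ^ 2) (sq_nonneg _) * NNReal.mk (σ ^ 2) (sq_nonneg σ) ≤
        NNReal.mk (V * σ ^ 2) (by positivity) from
      HasSubgaussianMGF.mono_proxy h2 hle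
    rw [← NNReal.coe_le_coe, NNReal.coe_sum]
    change ∑ i, a i ^ 2 * σ ^ 2 ≤ V * σ ^ 2
    rw [← Finset.sum_mul]
    refine mul_le_mul_of_nonneg_right ?_ (sq_nonneg σ)
    simpa [dotProduct, sq] using ha
  have hr : 0 ≤ √V * (σ * √(2 * L)) := by positivity
  have hexp : -(√V * (σ * √(2 * L))) ^ 2 / (2 * (V * σ ^ 2)) = -L := by
    rw [mul_pow, mul_pow, Real.sq_sqrt hV.le, Real.sq_sqrt (by positivity)]
    field_simp
  have hp := hs.measure_ge_le hr
  have hm := hs.neg.measure_ge_le hr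
  change _ ≤ Real.exp (-(√V * (σ * √(2 * L))) ^ 2 / (2 * (V * σ ^ 2))) at hp
  change _ ≤ Real.exp (-(√V * (σ * √(2 * L))) ^ 2 / (2 * (V * σ ^ 2))) at hm
  rw [hexp] at hp hm
  calc _ ≤ P.real ({w | √V * (σ * √(2 * L)) ≤ a ⬝ᵥ fun i => ξ i w} ∪
        {w | √V * (σ * √(2 * L)) ≤ (-fun w => a ⬝ᵥ fun i => ξ i w) w}) := by
        refine measureReal_mono ?_
        intro w hw
        rcases lt_abs.1 (Set.mem_ofPred.1 hw) with h | h
        · exact Or.inl h.le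
        · exact Or.inr h.le
    _ ≤ _ := (measureReal_union_le _ _).trans (by linarith)

theorem exists_event_abs_linear_le {Ω : Type*} [MeasurableSpace Ω] (P : Measure Ω)
    [IsProbabilityMeasure P] {ι : Type*} [Fintype ι] {p : ℕ} {ξ : ι → Ω → ℝ}
    (hmeas : ∀ i, Measurable (ξ i)) (hind : iIndepFun ξ P)
    {σ : ℝ} (hsub : ∀ i, HasSubgaussianMGF (ξ i) ⟨σ ^ 2, sq_nonneg σ⟩ P) (hσ : 0 < σ)
    (a : Fin p → ι → ℝ) {V : Fin p → ℝ} (hV : ∀ j, 0 < V j) (ha : ∀ j, a j ⬝ᵥ a j ≤ V j)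
    {η : ℝ} (hη0 : 0 < η) (hη1 : η < 1) :
    ∃ E : Set Ω, MeasurableSet E ∧ ENNReal.ofReal (1 - η) < P E ∧ ∀ w ∈ E, ∀ j,
      |a j ⬝ᵥ fun i => ξ i w| ≤ √(V j) * (σ * √(2 * Real.log (4 * (p : ℝ) / η))) := by
  set L := Real.log (4 * (p : ℝ) / η) with hLdef
  have hB : ∀ j, MeasurableSet {w | √(V j) * (σ * √(2 * L)) < |a j ⬝ᵥ fun i => ξ i w|} := by
    intro j
    refine measurableSet_lt measurable_const ?_
    have : Measurable fun w => ∑ i, a j i * ξ i w :=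
      Finset.measurable_sum _ fun i _ => (hmeas i).const_mul _
    exact measurable_norm.comp this
  set B := ⋃ j, {w | √(V j) * (σ * √(2 * L)) < |a j ⬝ᵥ fun i => ξ i w|}
  have hBm : MeasurableSet B := MeasurableSet.iUnion hB
  -- Each of the p forms fails with probability at most 2·η/(4p). The total η/2 leaves room for the
  -- strict inequality 1 − η < P E.
  have hPB : P.real B ≤ η / 2 := by
    refine (measureReal_iUnion_fintype_le _).trans ?_
    rcases Nat.eq_zero_or_pos p with rfl | hp
    · simp; positivity
    have hp' : (1 : ℝ) ≤ p := by exact_mod_cast hp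
    have hL : 0 ≤ L := Real.log_nonneg (by rw [le_div_iff₀ hη0]; linarith)
    have hE : Real.exp (-L) = η / (4 * p) := by
      rw [Real.exp_neg, hLdef, Real.exp_log (by positivity), inv_div]
    calc _ ≤ ∑ _j : Fin p, 2 * Real.exp (-L) := Finset.sum_le_sum fun j _ =>
          measure_abs_linear_gt_le hind hsub hσ (a j) (hV j) (ha j) hL
      _ = η / 2 := by
          rw [hE]; simp; field_simp; norm_num
  refine ⟨Bᶜ, hBm.compl, ?_, ?_⟩
  · rw [← ofReal_measureReal (μ := P) (s := Bᶜ), probReal_compl_eq_one_sub hBm]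
    exact (ENNReal.ofReal_lt_ofReal_iff (by linarith)).2 (by linarith)
  · intro w hw j
    simp only [B, Set.mem_compl_iff, Set.mem_iUnion, Set.mem_ofPred_eq, not_exists, not_lt] at hw
    exact hw j

/-! ### Linear algebra of the restricted design -/

theorem mulVec_eq_colsOf_mulVec {ι : Type*} {p : ℕ} (X : Matrix ι (Fin p) ℝ) {F : Finset (Fin p)}
    {b : Fin p → ℝ} (hb : coefSupp b ⊆ F) : X *ᵥ b = colsOf X F *ᵥ fun i => b i := by
  funext i
  simp only [Matrix.mulVec, dotProduct, colsOf]
  rw [Finset.sum_coe_sort F (fun j => X i j * b j)]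
  refine (Finset.sum_subset (Finset.subset_univ F) fun j _ hj => ?_).symm
  have : b j = 0 := by
    by_contra h
    exact hj (hb (by simp [coefSupp, h]))
  simp [this]

noncomputable section

/-- Extension by zero of a coefficient vector on `F`. -/
def extendCoef {p : ℕ} {F : Finset (Fin p)} (v : {j // j ∈ F} → ℝ) : Fin p → ℝ :=
  fun j => if h : j ∈ F then v ⟨j, h⟩ else 0

end

theorem extendCoef_apply {p : ℕ} {F : Finset (Fin p)} (v : {j // j ∈ F} → ℝ) :
    (fun i : {j // j ∈ F} => extendCoef v i) = v := by
  funext i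
  simp [extendCoef]

theorem coefSupp_extendCoef {p : ℕ} {F : Finset (Fin p)} (v : {j // j ∈ F} → ℝ) :
    coefSupp (extendCoef v) ⊆ F := by
  intro j hj
  by_contra h
  simp [coefSupp, extendCoef, h] at hj

theorem sum_sq_extendCoef {p : ℕ} {F : Finset (Fin p)} (v : {j // j ∈ F} → ℝ) :
    ∑ j, extendCoef v j ^ 2 = v ⬝ᵥ v := by
  rw [← Finset.sum_subset (Finset.subset_univ F), ← Finset.sum_coe_sort F]
  · simp [extendCoef, dotProduct, sq]
  · intro j _ hj
    simp [extendCoef, hj]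

theorem rhoX_mul_sum_sq_le {ι : Type*} [Fintype ι] {p : ℕ} (X : Matrix ι (Fin p) ℝ)
    {F : Finset (Fin p)} {b : Fin p → ℝ} (hb : coefSupp b ⊆ F)
    (hN : 0 < (Fintype.card ι : ℝ)) :
    (Fintype.card ι : ℝ) * rhoX X F * ∑ j, b j ^ 2 ≤ (X *ᵥ b) ⬝ᵥ (X *ᵥ b) := by
  by_cases h0 : b = 0
  · subst h0; simp
  have hpos : 0 < ∑ j, b j ^ 2 := by
    obtain ⟨j, hj⟩ := Function.ne_iff.1 h0
    exact Finset.sum_pos' (fun _ _ => sq_nonneg _) ⟨j, Finset.mem_univ j, sq_pos_of_ne_zero hj⟩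
  have hle : rhoX X F ≤ ((∑ i, (X *ᵥ b) i ^ 2) / (Fintype.card ι : ℝ)) / ∑ j, b j ^ 2 := by
    refine csInf_le ⟨0, ?_⟩ ⟨b, h0, hb, rfl⟩
    rintro r ⟨β, -, -, rfl⟩
    positivity
  rw [le_div_iff₀ hpos, le_div_iff₀ hN] at hle
  have : (X *ᵥ b) ⬝ᵥ (X *ᵥ b) = ∑ i, (X *ᵥ b) i ^ 2 := by simp [dotProduct, sq]
  rw [this]
  linarith

theorem rhoX_mul_le_colsOf {ι : Type*} [Fintype ι] {p : ℕ} (X : Matrix ι (Fin p) ℝ)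
    {F : Finset (Fin p)} (v : {j // j ∈ F} → ℝ) (hN : 0 < (Fintype.card ι : ℝ)) :
    (Fintype.card ι : ℝ) * rhoX X F * (v ⬝ᵥ v) ≤ (colsOf X F *ᵥ v) ⬝ᵥ (colsOf X F *ᵥ v) := by
  have := rhoX_mul_sum_sq_le X (coefSupp_extendCoef v) hN
  rwa [sum_sq_extendCoef, mulVec_eq_colsOf_mulVec X (coefSupp_extendCoef v),
    extendCoef_apply] at this

theorem rhoX_le_one {ι : Type*} [Fintype ι] {p : ℕ} (X : Matrix ι (Fin p) ℝ)
    {F : Finset (Fin p)} (hF : F.Nonempty) (hN : 0 < (Fintype.card ι : ℝ))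
    (hX : ∀ j, (∑ i, X i j ^ 2) / (Fintype.card ι : ℝ) = 1) : rhoX X F ≤ 1 := by
  obtain ⟨j, hj⟩ := hF
  have hs : coefSupp (Pi.single j (1 : ℝ)) ⊆ F := by
    intro i hi
    by_cases h : i = j
    · exact h ▸ hj
    · simp [coefSupp, h] at hi
  have h := rhoX_mul_sum_sq_le X hs hN
  have h1 : ∑ i, (Pi.single j (1 : ℝ) : Fin p → ℝ) i ^ 2 = 1 := by
    rw [Finset.sum_eq_single j] <;> simp +contextual
  have h2 : (X *ᵥ Pi.single j 1) ⬝ᵥ (X *ᵥ Pi.single j 1) = (Fintype.card ι : ℝ) := by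
    rw [← (div_eq_one_iff_eq hN.ne').1 (hX j)]
    simp [dotProduct, sq]
  rw [h1, h2] at h
  nlinarith

/-- A kernel vector v of the Gram matrix has ‖X_F v‖ = 0, so ρ > 0 forces v = 0. Any coordinate of v
witnesses that F is nonempty, so the conditional hypothesis suffices. -/
theorem isUnit_det_gram {ι : Type*} [Fintype ι] {p : ℕ} (X : Matrix ι (Fin p) ℝ)
    {F : Finset (Fin p)} (hN : 0 < (Fintype.card ι : ℝ)) (hρ : F.Nonempty → 0 < rhoX X F) :
    IsUnit ((colsOf X F)ᵀ * colsOf X F).det := by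
  rw [← Matrix.isUnit_iff_isUnit_det, ← Matrix.mulVec_injective_iff_isUnit]
  rw [← Matrix.coe_mulVecLin, injective_iff_map_eq_zero]
  intro v hv
  have hv' : ((colsOf X F)ᵀ * colsOf X F) *ᵥ v = 0 := hv
  funext i
  have hpos := hρ ⟨i.1, i.2⟩
  have h := rhoX_mul_le_colsOf X v hN
  have h0 : (colsOf X F *ᵥ v) ⬝ᵥ (colsOf X F *ᵥ v) = 0 := by
    rw [Matrix.dotProduct_mulVec, Matrix.vecMul_mulVec, ← Matrix.mulVec_transpose]
    simp [hv']
  rw [h0] at h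
  have : v ⬝ᵥ v = 0 := le_antisymm (nonpos_of_mul_nonpos_right h (by positivity))
    (Finset.sum_nonneg fun i _ => mul_self_nonneg _)
  exact congrFun (dotProduct_self_eq_zero.1 this) i

noncomputable section

/-- For `j ∈ F`, the vector dual to the `j`-th column within the span of the columns in `F`;
for `j ∉ F`, the residual of the `j`-th column after regression on the columns in `F`. -/
def dualCol {ι : Type*} [Fintype ι] {p : ℕ} (X : Matrix ι (Fin p) ℝ) (F : Finset (Fin p))
    (j : Fin p) : ι → ℝ :=
  if h : j ∈ F then
    colsOf X F *ᵥ (((colsOf X F)ᵀ * colsOf X F)⁻¹ *ᵥ Pi.single ⟨j, h⟩ 1)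
  else (fun i => X i j) -
    colsOf X F *ᵥ (((colsOf X F)ᵀ * colsOf X F)⁻¹ *ᵥ ((colsOf X F)ᵀ *ᵥ fun i => X i j))

end

section

variable {ι : Type*} [Fintype ι] {p : ℕ} (X : Matrix ι (Fin p) ℝ) {F : Finset (Fin p)}

theorem dualCol_dotProduct_of_mem {j : Fin p} (hj : j ∈ F) (u : ι → ℝ) :
    dualCol X F j ⬝ᵥ u =
      (((colsOf X F)ᵀ * colsOf X F)⁻¹ *ᵥ ((colsOf X F)ᵀ *ᵥ u)) ⟨j, hj⟩ := by
  have hsymm : (((colsOf X F)ᵀ * colsOf X F)⁻¹)ᵀ = ((colsOf X F)ᵀ * colsOf X F)⁻¹ := by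
    rw [Matrix.transpose_nonsing_inv, Matrix.transpose_mul, Matrix.transpose_transpose]
  rw [dualCol, dif_pos hj, dotProduct_comm, Matrix.dotProduct_mulVec, ← Matrix.mulVec_transpose,
    Matrix.dotProduct_mulVec, ← Matrix.mulVec_transpose, hsymm, dotProduct_single_one]

theorem dualCol_dotProduct_mulVec_of_mem (hG : IsUnit ((colsOf X F)ᵀ * colsOf X F).det)
    {j : Fin p} (hj : j ∈ F) {b : Fin p → ℝ} (hb : coefSupp b ⊆ F) :
    dualCol X F j ⬝ᵥ (X *ᵥ b) = b j := by
  rw [dualCol_dotProduct_of_mem X hj, mulVec_eq_colsOf_mulVec X hb, Matrix.mulVec_mulVec,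
    Matrix.mulVec_mulVec, Matrix.mul_assoc, Matrix.nonsing_inv_mul _ hG, Matrix.one_mulVec]

theorem transpose_mulVec_dualCol_of_notMem (hG : IsUnit ((colsOf X F)ᵀ * colsOf X F).det)
    {j : Fin p} (hj : j ∉ F) : (colsOf X F)ᵀ *ᵥ dualCol X F j = 0 := by
  rw [dualCol, dif_neg hj, Matrix.mulVec_sub, Matrix.mulVec_mulVec, Matrix.mulVec_mulVec,
    Matrix.mul_nonsing_inv _ hG, Matrix.one_mulVec, sub_self]

theorem dualCol_dotProduct_colsOf_of_notMem (hG : IsUnit ((colsOf X F)ᵀ * colsOf X F).det)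
    {j : Fin p} (hj : j ∉ F) (v : {j // j ∈ F} → ℝ) :
    dualCol X F j ⬝ᵥ (colsOf X F *ᵥ v) = 0 := by
  rw [Matrix.dotProduct_mulVec, ← Matrix.mulVec_transpose,
    transpose_mulVec_dualCol_of_notMem X hG hj, zero_dotProduct]

theorem dualCol_dotProduct_mulVec_of_notMem (hG : IsUnit ((colsOf X F)ᵀ * colsOf X F).det)
    {j : Fin p} (hj : j ∉ F) {b : Fin p → ℝ} (hb : coefSupp b ⊆ F) :
    dualCol X F j ⬝ᵥ (X *ᵥ b) = 0 := by
  rw [mulVec_eq_colsOf_mulVec X hb, dualCol_dotProduct_colsOf_of_notMem X hG hj]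

/-- Pythagoras: the column is the orthogonal sum of its projection and `dualCol`. -/
theorem dualCol_dotProduct_self_le_of_notMem (hG : IsUnit ((colsOf X F)ᵀ * colsOf X F).det)
    {j : Fin p} (hj : j ∉ F) :
    dualCol X F j ⬝ᵥ dualCol X F j ≤ ∑ i, X i j ^ 2 := by
  set v := ((colsOf X F)ᵀ * colsOf X F)⁻¹ *ᵥ ((colsOf X F)ᵀ *ᵥ fun i => X i j)
  have hx : (fun i => X i j) = dualCol X F j + colsOf X F *ᵥ v := by
    rw [dualCol, dif_neg hj, sub_add_cancel]
  have h0 := dualCol_dotProduct_colsOf_of_notMem X hG hj v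
  have hsq : ∑ i, X i j ^ 2 = (fun i => X i j) ⬝ᵥ fun i => X i j := by simp [dotProduct, sq]
  rw [hsq, hx, add_dotProduct, dotProduct_add, dotProduct_add, dotProduct_comm (colsOf X F *ᵥ v)
    (dualCol X F j), h0]
  have : 0 ≤ (colsOf X F *ᵥ v) ⬝ᵥ (colsOf X F *ᵥ v) :=
    Finset.sum_nonneg fun i _ => mul_self_nonneg _
  linarith

/-- With v = G⁻¹e_j and G the Gram matrix, the squared norm equals v_j. The eigenvalue bound gives
Nρ v_j² ≤ Nρ‖v‖² ≤ ‖X_F v‖² = v_j, hence v_j ≤ 1/(Nρ). -/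
theorem dualCol_dotProduct_self_le_of_mem (hG : IsUnit ((colsOf X F)ᵀ * colsOf X F).det)
    (hN : 0 < (Fintype.card ι : ℝ)) (hρ : 0 < rhoX X F) {j : Fin p} (hj : j ∈ F) :
    dualCol X F j ⬝ᵥ dualCol X F j ≤ 1 / ((Fintype.card ι : ℝ) * rhoX X F) := by
  set v : {j // j ∈ F} → ℝ :=
    ((colsOf X F)ᵀ * colsOf X F)⁻¹ *ᵥ Pi.single ⟨j, hj⟩ 1
  have hd : dualCol X F j = colsOf X F *ᵥ v := by rw [dualCol, dif_pos hj]
  have hv : dualCol X F j ⬝ᵥ dualCol X F j = v ⟨j, hj⟩ := by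
    conv_lhs => rw [hd, ← hd]
    rw [dualCol_dotProduct_of_mem X hj, hd, Matrix.mulVec_mulVec, Matrix.mulVec_mulVec,
      Matrix.mul_assoc, Matrix.nonsing_inv_mul _ hG, Matrix.one_mulVec]
  have h := rhoX_mul_le_colsOf X v hN
  rw [← hd, hv] at h
  have hvv : v ⟨j, hj⟩ ^ 2 ≤ v ⬝ᵥ v := by
    rw [sq]
    exact Finset.single_le_sum (f := fun i => v i * v i) (fun i _ => mul_self_nonneg _)
      (Finset.mem_univ _)
  have hc : 0 < (Fintype.card ι : ℝ) * rhoX X F := by positivity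
  have h2 : (Fintype.card ι : ℝ) * rhoX X F * v ⟨j, hj⟩ ^ 2 ≤ v ⟨j, hj⟩ :=
    (mul_le_mul_of_nonneg_left hvv hc.le).trans h
  rw [hv, le_div_iff₀ hc]
  by_contra hlt
  push Not at hlt
  have hpos : 0 < v ⟨j, hj⟩ := by
    by_contra hneg
    push Not at hneg
    nlinarith
  nlinarith

/-- The numbers paired here form d = G⁻¹X_Fᵀu, for which ‖X_F d‖² = dᵀX_Fᵀu; the eigenvalue bound is
then applied to d. -/
theorem rhoX_mul_sum_dualCol_sq_le (hG : IsUnit ((colsOf X F)ᵀ * colsOf X F).det)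
    (hN : 0 < (Fintype.card ι : ℝ)) (u : ι → ℝ) :
    (Fintype.card ι : ℝ) * rhoX X F * ∑ j ∈ F, (dualCol X F j ⬝ᵥ u) ^ 2 ≤
      ∑ j ∈ F, (dualCol X F j ⬝ᵥ u) * ∑ i, X i j * u i := by
  set d := ((colsOf X F)ᵀ * colsOf X F)⁻¹ *ᵥ ((colsOf X F)ᵀ *ᵥ u)
  have hd : ∀ i : {j // j ∈ F}, dualCol X F i ⬝ᵥ u = d i :=
    fun i => dualCol_dotProduct_of_mem X i.2 u
  have h := rhoX_mul_le_colsOf X d hN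
  have hu : (colsOf X F *ᵥ d) ⬝ᵥ (colsOf X F *ᵥ d) = d ⬝ᵥ ((colsOf X F)ᵀ *ᵥ u) := by
    conv_lhs => rw [Matrix.dotProduct_mulVec, ← Matrix.mulVec_transpose, Matrix.mulVec_mulVec]
    rw [Matrix.mulVec_mulVec, Matrix.mul_nonsing_inv _ hG, Matrix.one_mulVec, dotProduct_comm]
  rw [hu] at h
  rw [← Finset.sum_coe_sort F, ← Finset.sum_coe_sort F]
  simp only [hd]
  simpa [dotProduct, sq, Matrix.mulVec, colsOf] using h

theorem muX_nonneg : 0 ≤ muX X F :=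
  Real.iSup_nonneg fun _ => Finset.sum_nonneg fun _ _ => abs_nonneg _

/-- The projection of x_j on the span of F has coefficient vector of ℓ¹ norm at most μ, so Hölder
bounds its correlation with u by μM. -/
theorem abs_corr_le_muX_mul_add {j : Fin p} (hj : j ∉ F) (u : ι → ℝ) {M : ℝ}
    (hM : ∀ i ∈ F, |∑ k, X k i * u k| ≤ M) (hM0 : 0 ≤ M) :
    |∑ k, X k j * u k| ≤ muX X F * M + |dualCol X F j ⬝ᵥ u| := by
  set v := ((colsOf X F)ᵀ * colsOf X F)⁻¹ *ᵥ ((colsOf X F)ᵀ *ᵥ fun i => X i j) with hv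
  have hx : (fun i => X i j) = dualCol X F j + colsOf X F *ᵥ v := by
    rw [dualCol, dif_neg hj, sub_add_cancel]
  have hsum : ∑ k, X k j * u k = dualCol X F j ⬝ᵥ u + ∑ i, v i * ∑ k, X k i * u k := by
    change (fun i => X i j) ⬝ᵥ u = _
    rw [hx, add_dotProduct, dotProduct_comm (colsOf X F *ᵥ v), Matrix.dotProduct_mulVec,
      ← Matrix.mulVec_transpose, dotProduct_comm _ v]
    rfl
  have hmu : ∑ i, |v i| ≤ muX X F :=
    le_ciSup (f := fun j : {j : Fin p // j ∉ F} => ∑ i, |(((colsOf X F)ᵀ * colsOf X F)⁻¹ *ᵥ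
      ((colsOf X F)ᵀ *ᵥ fun i' => X i' j.1)) i|) (Set.finite_range _).bddAbove ⟨j, hj⟩
  calc |∑ k, X k j * u k| ≤ |dualCol X F j ⬝ᵥ u| + |∑ i, v i * ∑ k, X k i * u k| := by
        rw [hsum]; exact abs_add_le _ _
    _ ≤ |dualCol X F j ⬝ᵥ u| + ∑ i, |v i| * M := by
        refine add_le_add_right ((Finset.abs_sum_le_sum_abs _ _).trans ?_) _
        refine Finset.sum_le_sum fun i _ => ?_
        rw [abs_mul]
        exact mul_le_mul_of_nonneg_left (hM i i.2) (abs_nonneg _)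
    _ ≤ _ := by
        rw [← Finset.sum_mul]
        nlinarith

/-! ### Least squares and forward selection paths -/

theorem IsLeastSquares.corr_resid_eq_zero {X : Matrix ι (Fin p) ℝ} {y : ι → ℝ}
    {b : Fin p → ℝ} (h : IsLeastSquares X y F b) {j : Fin p} (hj : j ∈ F) :
    ∑ i, X i j * resid X y b i = 0 := by
  set c := ∑ i, X i j * resid X y b i with hc
  set q := ∑ i, X i j ^ 2 with hq
  have key : ∀ t : ℝ, 0 ≤ t ^ 2 * q - 2 * t * c := by
    intro t
    have hs : coefSupp (b + t • Pi.single j (1 : ℝ)) ⊆ F := by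
      intro i hi
      by_cases hij : i = j
      · exact hij ▸ hj
      · refine h.1 ?_
        simpa [coefSupp, hij] using hi
    have h2 := h.2 _ hs
    have h3 : ∀ i, (X *ᵥ (b + t • Pi.single j (1 : ℝ))) i = (X *ᵥ b) i + t * X i j := by
      intro i
      simp [Matrix.mulVec_add, Matrix.mulVec_smul]
    have h4 : ∑ i, ((X *ᵥ (b + t • Pi.single j (1 : ℝ))) i - y i) ^ 2
        = ∑ i, ((X *ᵥ b) i - y i) ^ 2 + (t ^ 2 * q - 2 * t * c) := by
      rw [hq, hc, Finset.mul_sum, Finset.mul_sum, ← Finset.sum_sub_distrib,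
        ← Finset.sum_add_distrib]
      refine Finset.sum_congr rfl fun i _ => ?_
      rw [h3, resid]
      ring
    linarith
  have hq0 : 0 ≤ q := Finset.sum_nonneg fun _ _ => sq_nonneg _
  -- Dividing by q + 1 instead of q avoids a separate case for a zero column and still forces c = 0.
  have h1 := key (c / (q + 1))
  have h2 : (c / (q + 1)) ^ 2 * q - 2 * (c / (q + 1)) * c
      = -(c ^ 2 * (q + 2)) / (q + 1) ^ 2 := by
    field_simp
    ring
  rw [h2, le_div_iff₀ (by positivity)] at h1
  have : c ^ 2 * (q + 2) = 0 := le_antisymm (by linarith) (by positivity)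
  rcases mul_eq_zero.1 this with h | h
  · exact pow_eq_zero_iff (two_ne_zero) |>.1 h
  · linarith

end

/-! ### Thresholding `qHat` and the first stages of a path -/

theorem mem_firstVars {p N : ℕ} {path : Fin N → Fin p} {m : ℕ} {j : Fin p} :
    j ∈ firstVars path m ↔ ∃ s : Fin N, (s : ℕ) < m ∧ path s = j := by
  simp [firstVars]

theorem qHat_path {p N : ℕ} {path : Fin N → Fin p} (hinj : Function.Injective path) (s : Fin N) :
    qHat path (path s) = ((N : ℝ) - s) / N := by
  rw [qHat, Finset.sum_eq_single s]
  · simp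
  · intro t _ hts
    rw [if_neg fun h => hts (hinj h)]
  · simp

theorem qHat_eq_zero {p N : ℕ} {path : Fin N → Fin p} {j : Fin p} (hj : ∀ s, path s ≠ j) :
    qHat path j = 0 :=
  Finset.sum_eq_zero fun s _ => if_neg (hj s)

/-- Stopping at stage l = last + 2 puts the cutoff exactly at the score of stage l, and the strict
inequality keeps stages up to last + 1. When l = N + 1 the cutoff is 0, and strictness excludes the
variables never included. -/
theorem qSelected_cThreshold {p N : ℕ} {path : Fin N → Fin p} (hinj : Function.Injective path)
    (last : Fin N) :
    qSelected path (cThreshold N (last + 2)) = firstVars path (last + 1) := by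
  have hN : 0 < (N : ℝ) := by exact_mod_cast last.pos
  ext j
  have hsel : j ∈ qSelected path (cThreshold N (last + 2)) ↔
      ((N : ℝ) + 1 - ((last : ℕ) + 2)) / N < qHat path j := by
    simp [qSelected, cThreshold]
  rw [mem_firstVars, hsel]
  by_cases hj : ∃ s, path s = j
  · obtain ⟨s, rfl⟩ := hj
    rw [qHat_path hinj, div_lt_div_iff_of_pos_right hN]
    constructor
    · intro h
      refine ⟨s, ?_, rfl⟩
      have : (s : ℝ) < last + 1 := by linarith
      exact_mod_cast this
    · rintro ⟨t, ht, hts⟩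
      obtain rfl := hinj hts
      have : (t : ℝ) < last + 1 := by exact_mod_cast ht
      linarith
  · push Not at hj
    rw [qHat_eq_zero hj]
    have : ((last : ℕ) : ℝ) + 1 ≤ N := by exact_mod_cast last.2
    constructor
    · intro h
      exact absurd h (not_lt.2 (div_nonneg (by linarith) hN.le))
    · rintro ⟨s, -, hs⟩
      exact absurd hs (hj s)

/-! ### Deterministic analysis of forward selection on the noise event -/

section

variable {ι : Type*} [Fintype ι] {p : ℕ} {X : Matrix ι (Fin p) ℝ}

theorem abs_corr_eq (hN : 0 < (Fintype.card ι : ℝ))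
    (hX : ∀ j, (∑ i, X i j ^ 2) / (Fintype.card ι : ℝ) = 1) (u : ι → ℝ) (j : Fin p) :
    |∑ i, X i j * u i| = √(Fintype.card ι : ℝ) * absCorr X u j := by
  have h := (div_eq_one_iff_eq hN.ne').1 (hX j)
  rw [absCorr, h, mul_div_cancel₀ _ (Real.sqrt_pos.2 hN).ne']

theorem resid_eq (y : ι → ℝ) (β b : Fin p → ℝ) :
    resid X y b = (fun i => y i - (X *ᵥ β) i) + X *ᵥ β - X *ᵥ b := by
  funext i
  simp [resid]

/-- Included columns are orthogonal to the residual, so a bound over the remaining columns holds for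
all of them. -/
theorem abs_corr_le_of_absCorr_le (hN : 0 < (Fintype.card ι : ℝ))
    (hX : ∀ j, (∑ i, X i j ^ 2) / (Fintype.card ι : ℝ) = 1) {y : ι → ℝ} {S : Finset (Fin p)}
    {b : Fin p → ℝ} (hb : IsLeastSquares X y S b) {ω : ℝ} (hω0 : 0 ≤ ω)
    (hω : ∀ j, j ∉ S → absCorr X (resid X y b) j ≤ ω) (j : Fin p) :
    |∑ i, X i j * resid X y b i| ≤ √(Fintype.card ι : ℝ) * ω := by
  by_cases hj : j ∈ S
  · rw [hb.corr_resid_eq_zero hj, abs_zero]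
    positivity
  · rw [abs_corr_eq hN hX]
    exact mul_le_mul_of_nonneg_left (hω j hj) (Real.sqrt_nonneg _)

theorem IsForwardSelection.path_mem_coefSupp {N : ℕ} {y : ι → ℝ} {β : Fin p → ℝ}
    {path : Fin N → Fin p} {b : ℕ → Fin p → ℝ} (h : IsForwardSelection X y path b)
    (hN : 0 < (Fintype.card ι : ℝ))
    (hX : ∀ j, (∑ i, X i j ^ 2) / (Fintype.card ι : ℝ) = 1)
    (hG : IsUnit ((colsOf X (coefSupp β))ᵀ * colsOf X (coefSupp β)).det)
    (hμ : muX X (coefSupp β) < 1) {t : ℝ}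
    (hnoise : ∀ j, j ∉ coefSupp β →
      |dualCol X (coefSupp β) j ⬝ᵥ fun i => y i - (X *ᵥ β) i| ≤ √(Fintype.card ι : ℝ) * t)
    {last : Fin N}
    (hω : ∀ s ≤ last, t / (1 - muX X (coefSupp β)) < stageOmega X y path b s)
    (s : Fin N) (hs : s ≤ last) : path s ∈ coefSupp β := by
  induction s using WellFoundedLT.induction with
  | ind s ih =>
  by_contra hj
  have hS : firstVars path s ⊆ coefSupp β := by
    intro j hj
    obtain ⟨r, hr, rfl⟩ := mem_firstVars.1 hj
    have hrs : r < s := hr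
    exact ih r hrs (hrs.le.trans hs)
  have hLS := h.leastSquares s s.2.le
  have hω0 : 0 ≤ stageOmega X y path b s := div_nonneg (abs_nonneg _) (Real.sqrt_nonneg _)
  have hM := abs_corr_le_of_absCorr_le hN hX hLS hω0 (h.greedy s)
  have hsqrt := Real.sqrt_pos.2 hN
  have hle := abs_corr_le_muX_mul_add X hj (resid X y (b s)) (fun i _ => hM i)
    (mul_nonneg hsqrt.le hω0)
  -- Both Xβ and the current fit lie in the span of F, which `dualCol` annihilates; only noise
  -- remains.
  have hd : dualCol X (coefSupp β) (path s) ⬝ᵥ resid X y (b s) =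
      dualCol X (coefSupp β) (path s) ⬝ᵥ fun i => y i - (X *ᵥ β) i := by
    rw [resid_eq y β, dotProduct_sub, dotProduct_add,
      dualCol_dotProduct_mulVec_of_notMem X hG hj subset_rfl,
      dualCol_dotProduct_mulVec_of_notMem X hG hj (hLS.1.trans hS)]
    ring
  rw [hd, abs_corr_eq hN hX] at hle
  have h2 := hle.trans (add_le_add_right (hnoise _ hj) _)
  have h3 := (div_lt_iff₀ (sub_pos.2 hμ)).1 (hω s hs)
  have h4 : absCorr X (resid X y (b s)) (path s) = stageOmega X y path b s := rfl
  rw [h4] at h2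
  have h5 : √(Fintype.card ι : ℝ) * (stageOmega X y path b s * (1 - muX X (coefSupp β))) ≤
      √(Fintype.card ι : ℝ) * t := by linarith
  linarith [le_of_mul_le_mul_left h5 hsqrt]

theorem card_sdiff_le_of_absCorr_le {y : ι → ℝ} {β : Fin p → ℝ}
    {S : Finset (Fin p)} {b : Fin p → ℝ} (hS : S ⊆ coefSupp β) (hb : IsLeastSquares X y S b)
    (hN : 0 < (Fintype.card ι : ℝ))
    (hX : ∀ j, (∑ i, X i j ^ 2) / (Fintype.card ι : ℝ) = 1)
    (hρ : (coefSupp β).Nonempty → 0 < rhoX X (coefSupp β)) {t ω : ℝ} (ht : 0 ≤ t) (htω : t < ω)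
    (hnoise : ∀ j ∈ coefSupp β, |dualCol X (coefSupp β) j ⬝ᵥ fun i => y i - (X *ᵥ β) i| ≤
      √(1 / ((Fintype.card ι : ℝ) * rhoX X (coefSupp β))) * t)
    (hω : ∀ j, j ∉ S → absCorr X (resid X y b) j ≤ ω) :
    (coefSupp β \ S).card ≤ 2 * ((coefSupp β).filter (fun j =>
      |β j| < 3 * ω / (rhoX X (coefSupp β) * √(Fintype.card ι : ℝ)))).card := by
  rcases (coefSupp β \ S).eq_empty_or_nonempty with hT | hT
  · simp [hT]
  have hF : (coefSupp β).Nonempty := hT.mono Finset.sdiff_subset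
  have hG := isUnit_det_gram X hN hρ
  have hρ0 := hρ hF
  have hρ1 := rhoX_le_one X hF hN hX
  have hω0 : 0 < ω := ht.trans_lt htω
  have hcorr := abs_corr_le_of_absCorr_le hN hX hb hω0.le hω
  have hquad := rhoX_mul_sum_dualCol_sq_le X hG hN (resid X y b)
  set F := coefSupp β
  set ρ := rhoX X F
  set N := (Fintype.card ι : ℝ)
  set d : Fin p → ℝ := fun j => dualCol X F j ⬝ᵥ resid X y b
  set τ := ω / (ρ * √N) with hτ
  have hsq : √N * √N = N := Real.mul_self_sqrt hN.le
  have hsqrt : 0 < √N := Real.sqrt_pos.2 hN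
  have hτ0 : 0 < τ := by positivity
  have hNτ : √N * ω = N * ρ * τ := by
    rw [hτ]
    field_simp
    linarith
  have hsub : F \ S ⊆ F := Finset.sdiff_subset
  have hsum : ∑ j ∈ F \ S, (d j ^ 2 - τ * |d j|) ≤ 0 := by
    have h1 : ∑ j ∈ F, d j * ∑ i, X i j * resid X y b i ≤ N * ρ * ∑ j ∈ F \ S, τ * |d j| := by
      rw [← Finset.sum_subset hsub, Finset.mul_sum]
      · refine Finset.sum_le_sum fun j _ => (le_abs_self _).trans ?_
        rw [abs_mul]
        have := mul_le_mul_of_nonneg_left (hcorr j) (abs_nonneg (d j))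
        rw [hNτ] at this
        linarith
      · intro j hj hjS
        have : j ∈ S := by simpa [hj] using hjS
        rw [hb.corr_resid_eq_zero this, mul_zero]
    have h2 : ∑ j ∈ F \ S, d j ^ 2 ≤ ∑ j ∈ F, d j ^ 2 :=
      Finset.sum_le_sum_of_subset_of_nonneg hsub fun _ _ _ => sq_nonneg _
    have h3 : N * ρ * ∑ j ∈ F \ S, d j ^ 2 ≤ N * ρ * ∑ j ∈ F \ S, τ * |d j| :=
      (mul_le_mul_of_nonneg_left h2 (by positivity)).trans (hquad.trans h1)
    rw [Finset.sum_sub_distrib]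
    linarith [le_of_mul_le_mul_left h3 (by positivity : 0 < N * ρ)]
  have hbig : ∀ j ∈ F \ S, ¬ |β j| < 3 * ω / (ρ * √N) → 2 * τ ≤ |d j| := by
    intro j hj hβ
    obtain ⟨hjF, hjS⟩ := Finset.mem_sdiff.1 hj
    have hbj : b j = 0 := by
      by_contra hne
      exact hjS (hb.1 (by simp [coefSupp, hne]))
    have hd : d j = (dualCol X F j ⬝ᵥ fun i => y i - (X *ᵥ β) i) + β j := by
      simp only [d]
      rw [resid_eq y β, dotProduct_sub, dotProduct_add,
        dualCol_dotProduct_mulVec_of_mem X hG hjF subset_rfl,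
        dualCol_dotProduct_mulVec_of_mem X hG hjF (hb.1.trans hS), hbj, sub_zero]
    -- This is where ρ ≤ 1 enters: the noise scale 1/√(Nρ) is at most 1/(ρ√N).
    have hs : √(1 / (N * ρ)) ≤ 1 / (ρ * √N) := by
      refine Real.sqrt_le_iff.2 ⟨by positivity, ?_⟩
      rw [div_pow, one_pow, mul_pow, Real.sq_sqrt hN.le]
      refine one_div_le_one_div_of_le (by positivity) ?_
      nlinarith [mul_le_mul_of_nonneg_left hρ1 (mul_pos hN hρ0).le]
    have hn : √(1 / (N * ρ)) * t ≤ τ := by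
      calc √(1 / (N * ρ)) * t ≤ 1 / (ρ * √N) * ω := by gcongr
        _ = τ := by rw [hτ]; ring
    have h3 : 3 * ω / (ρ * √N) = 3 * τ := by rw [hτ]; ring
    rw [h3, not_lt] at hβ
    have h4 := (hnoise j hjF).trans hn
    have h5 : |β j| ≤ |d j| + |dualCol X F j ⬝ᵥ fun i => y i - (X *ᵥ β) i| := by
      have : β j = d j - dualCol X F j ⬝ᵥ fun i => y i - (X *ᵥ β) i := by rw [hd]; ring
      calc |β j| = |d j - dualCol X F j ⬝ᵥ fun i => y i - (X *ᵥ β) i| := by rw [← this]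
        _ ≤ _ := abs_sub _ _
    linarith
  set small := (F \ S).filter (fun j => |β j| < 3 * ω / (ρ * √N))
  set big := (F \ S).filter (fun j => ¬ |β j| < 3 * ω / (ρ * √N))
  have hcard : small.card + big.card = (F \ S).card :=
    Finset.card_filter_add_card_filter_not _
  have hsmall : -(small.card * (τ ^ 2 / 4)) ≤ ∑ j ∈ small, (d j ^ 2 - τ * |d j|) := by
    rw [← mul_neg, ← nsmul_eq_mul]
    refine Finset.card_nsmul_le_sum _ _ _ fun j _ => ?_
    -- The minimum of x² − τx is −τ²/4, at x = τ/2.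
    nlinarith [sq_nonneg (|d j| - τ / 2), sq_abs (d j)]
  have hbigs : big.card * (2 * τ ^ 2) ≤ ∑ j ∈ big, (d j ^ 2 - τ * |d j|) := by
    rw [← nsmul_eq_mul]
    refine Finset.card_nsmul_le_sum _ _ _ fun j hj => ?_
    have := hbig j (Finset.mem_filter.1 hj).1 (Finset.mem_filter.1 hj).2
    -- For x ≥ 2τ, x² − τx − 2τ² = (x − 2τ)(x + τ) ≥ 0.
    nlinarith [sq_abs (d j), mul_nonneg (sub_nonneg.2 this) (by positivity : 0 ≤ |d j| + τ)]
  rw [← Finset.sum_filter_add_sum_filter_not (F \ S)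
    (fun j => |β j| < 3 * ω / (ρ * √N))] at hsum
  have hle : (big.card : ℝ) ≤ small.card := by
    have h1 : (big.card * 2 - small.card / 4 : ℝ) * τ ^ 2 ≤ 0 := by
      linarith
    have h2 := nonpos_of_mul_nonpos_left h1 (by positivity)
    have h3 : (0 : ℝ) ≤ big.card := Nat.cast_nonneg _
    have h4 : (0 : ℝ) ≤ small.card := Nat.cast_nonneg _
    linarith
  have hle' : big.card ≤ small.card := by exact_mod_cast hle
  have hmono : small.card ≤ (F.filter (fun j => |β j| < 3 * ω / (ρ * √N))).card :=
    Finset.card_le_card (Finset.filter_subset_filter _ hsub)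
  omega

end

/-! ### Subsample size and assembly -/

theorem card_subIdx {n K : ℕ} (fold : Fin n → Fin K)
    (hfold : ∀ k' : Fin K, K * (Finset.univ.filter (fun i => fold i = k')).card = n)
    (k : Fin K) :
    (Fintype.card (SubIdx fold k) : ℝ) = (n : ℝ) * ((K : ℝ) - 1) / (K : ℝ) := by
  have hK : (K : ℝ) ≠ 0 := by exact_mod_cast k.pos.ne'
  have h1 : Fintype.card (SubIdx fold k) =
      (Finset.univ.filter (fun i => ¬ fold i = k)).card := Fintype.card_subtype _
  have h2 := Finset.card_filter_add_card_filter_not (s := Finset.univ) (fun i => fold i = k)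
  rw [← h1, Finset.card_univ, Fintype.card_fin] at h2
  have h3 : ((Finset.univ.filter (fun i => fold i = k)).card : ℝ) +
      Fintype.card (SubIdx fold k) = n := by exact_mod_cast h2
  have h4 : (K : ℝ) * (Finset.univ.filter (fun i => fold i = k)).card = n := by
    exact_mod_cast hfold k
  rw [eq_div_iff hK]
  linear_combination (K : ℝ) * h3 - h4

theorem lemma4 {Ω : Type*} [MeasurableSpace Ω] (P : Measure Ω) [IsProbabilityMeasure P]
    {n p K : ℕ} (X : Matrix (Fin n) (Fin p) ℝ) (Y : Fin n → Ω → ℝ)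
    (βbar : Fin p → ℝ) (σ : ℝ)
    (fold : Fin n → Fin K)
    (hfold : ∀ k' : Fin K, K * (Finset.univ.filter (fun i => fold i = k')).card = n)
    (k : Fin K)
    (hA : DataAssumptions P (subDesign X fold k) (subResponse Y fold k) βbar σ)
    (η : ℝ) (hη0 : 0 < η) (hη1 : η < 1) :
    ∃ E : Set Ω, MeasurableSet E ∧ ENNReal.ofReal (1 - η) < P E ∧ ∀ w ∈ E,
      ∀ (path : Fin (pTilde n K p) → Fin p) (b : ℕ → Fin p → ℝ),
        IsForwardSelection (subDesign X fold k) (fun i => subResponse Y fold k i w) path b →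
        ∀ (ε : ℝ) (l : ℕ) (last : Fin (pTilde n K p)), (last : ℕ) + 2 = l →
          StopsAt (subDesign X fold k) (fun i => subResponse Y fold k i w) path b ε l →
          (∀ s : Fin (pTilde n K p), s ≤ last →
            1 / (1 - muX (subDesign X fold k) (coefSupp βbar)) * σ
                * √(2 * Real.log (4 * (p : ℝ) / η))
              < stageOmega (subDesign X fold k) (fun i => subResponse Y fold k i w) path b s) →
          qSelected path (cThreshold (pTilde n K p) l) ⊆ coefSupp βbar ∧
          (coefSupp βbar \ qSelected path (cThreshold (pTilde n K p) l)).card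
            ≤ 2 * ((coefSupp βbar).filter (fun j =>
                |βbar j| < 3 * stageOmega (subDesign X fold k)
                      (fun i => subResponse Y fold k i w) path b last
                    / (rhoX (subDesign X fold k) (coefSupp βbar)
                        * √((n : ℝ) * ((K : ℝ) - 1) / (K : ℝ))))).card := by
  rcases Nat.eq_zero_or_pos p with rfl | hp
  · refine ⟨Set.univ, MeasurableSet.univ, ?_, fun w _ path _ _ _ _ last => (path last).elim0⟩
    rw [measure_univ, ENNReal.ofReal_lt_one]
    linarith
  have hcard := card_subIdx fold hfold k
  rw [← hcard]
  set X' := subDesign X fold k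
  set F := coefSupp βbar with hFdef
  -- An empty subsample would make the normalization of a column read 0 = 1, since division by zero
  -- is 0.
  have hN : 0 < (Fintype.card (SubIdx fold k) : ℝ) := by
    refine lt_of_le_of_ne (Nat.cast_nonneg _) fun h => ?_
    have := hA.normalized ⟨0, hp⟩
    rw [← h, div_zero] at this
    exact zero_ne_one this
  set N := (Fintype.card (SubIdx fold k) : ℝ)
  have hG := isUnit_det_gram X' hN hA.sparse_eigenvalue
  set ξ : SubIdx fold k → Ω → ℝ := fun i w => subResponse Y fold k i w - (X' *ᵥ βbar) i
  have hmeas : ∀ i, Measurable (ξ i) := fun i => (hA.measurable i).sub_const _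
  have hind : iIndepFun ξ P :=
    hA.indep.comp (fun i x => x - (X' *ᵥ βbar) i) fun i => measurable_id.sub_const _
  have hsub : ∀ i, HasSubgaussianMGF (ξ i) ⟨σ ^ 2, sq_nonneg σ⟩ P := by
    intro i
    have := hA.subgaussian i
    rwa [hA.mean_eq i] at this
  have hV : ∀ j, 0 < if j ∈ F then 1 / (N * rhoX X' F) else N := by
    intro j
    split_ifs with hj
    · have := hA.sparse_eigenvalue ⟨j, hj⟩
      positivity
    · exact hN
  have ha : ∀ j, dualCol X' F j ⬝ᵥ dualCol X' F j ≤
      if j ∈ F then 1 / (N * rhoX X' F) else N := by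
    intro j
    split_ifs with hj
    · exact dualCol_dotProduct_self_le_of_mem X' hG hN (hA.sparse_eigenvalue ⟨j, hj⟩) hj
    · exact (dualCol_dotProduct_self_le_of_notMem X' hG hj).trans_eq
        ((div_eq_one_iff_eq hN.ne').1 (hA.normalized j))
  obtain ⟨E, hE, hPE, hnoise⟩ :=
    exists_event_abs_linear_le P hmeas hind hsub hA.sigma_pos (dualCol X' F) hV ha hη0 hη1
  refine ⟨E, hE, hPE, fun w hw path b hfs ε l last hl hhalt hω => ?_⟩
  subst hl
  set t := σ * √(2 * Real.log (4 * (p : ℝ) / η))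
  have ht : 0 ≤ t := mul_nonneg hA.sigma_pos.le (Real.sqrt_nonneg _)
  have hμ : muX X' F < 1 := hA.irrepresentable
  have hω' : ∀ s ≤ last, t / (1 - muX X' F) <
      stageOmega X' (fun i => subResponse Y fold k i w) path b s := by
    intro s hs
    have := hω s hs
    rwa [mul_assoc, one_div_mul_eq_div] at this
  have hmem := hfs.path_mem_coefSupp hN hA.normalized hG hμ
    (fun j hj => by simpa only [if_neg (show j ∉ F from hj)] using hnoise w hw j) hω'
  rw [qSelected_cThreshold hfs.injective]
  have hS : firstVars path (last + 1) ⊆ F := by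
    intro j hj
    obtain ⟨s, hs, rfl⟩ := mem_firstVars.1 hj
    exact hmem s (Fin.le_def.2 (Nat.lt_succ_iff.1 hs))
  refine ⟨hS, ?_⟩
  -- The last included variable exceeded ε, so ω at that stage bounds every correlation remaining at
  -- the stop.
  have hεω : ε < stageOmega X' (fun i => subResponse Y fold k i w) path b last :=
    hhalt.1 last (by omega)
  refine card_sdiff_le_of_absCorr_le hS (hfs.leastSquares _ last.2) hN hA.normalized
    hA.sparse_eigenvalue ht (lt_of_le_of_lt ?_ (hω' last le_rfl))
    (fun j hj => by simpa only [if_pos (show j ∈ F from hj)] using hnoise w hw j)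
    fun j hj => (hhalt.2 j hj).trans hεω.le
  -- As μ ≥ 0, t ≤ t/(1 − μ), so t < ω.
  rw [le_div_iff₀ (sub_pos.2 hμ)]
  nlinarith [muX_nonneg X' (F := F)]
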